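/- For a real symmetric $n\times n$ matrix $A$ put $Q_A(z)={}^t z A z$ for $z\in\mathbb R^n$, and for $r\ge 0$ put $\Gamma_A^r=\{z\in\mathbb R^n : Q_A(z)\le r\}$, with topological boundary $\partial\Gamma_A^r$. Say that $\partial\Gamma_A^r$ is a variety of dimension $n-1$ if there is a point $z\in\partial\Gamma_A^r$ with $Az\neq 0$. Say that $\partial\Gamma_A^r$ and $\partial\Gamma_B^r$ intersect transversally at $z$ if $z\in\partial\Gamma_A^r\cap\partial\Gamma_B^r$ and the vectors $Az$ and $Bz$ are linearly independent. **Theorem 2.5.** Let $W$ be a non-trivial linear subspace of the space $\mathrm{Sym}(n,\mathbb R)$ of real symmetric $n\times n$ matrices, let $r\ge 0$, and let $A\in W$ have maximal rank in $W$, i.e. $\operatorname{rank}F\le\operatorname{rank}A$ for all $F\in W$. Let $(k,\ell_1)$ be the signature of $A$ ($k$ positive and $\ell_1$ negative eigenvalues, counted with multiplicity), and assume $k\ge 2$. Then there is $\delta>0$, depending only on $n$, $W$, $r$ and $A$, such that the following holds for every $B\in W$ with $\|B-A\|<\delta$. If $\partial\Gamma_A^r$ and $\partial\Gamma_B^r$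 are varieties of dimension $n-1$, and if there is no point at which $\partial\Gamma_A^r$ and $\partial\Gamma_B^r$ intersect transversally, then $\Gamma_A^r\subset\Gamma_B^r$ or $\Gamma_B^r\subset\Gamma_A^r$. -/

import Mathlib

open scoped Matrix Matrix.Norms.L2Operator

/-- The space of real symmetric `n × n` matrices. -/
def SymMat (n : ℕ) : Submodule ℝ (Matrix (Fin n) (Fin n) ℝ) where
  carrier := {A | A.IsSymm}
  add_mem' := fun hA hB => hA.add hB
  zero_mem' := Matrix.isSymm_zero
  smul_mem' := fun c _ hA => hA.smul c

/-- The quadratic form `Q_A(z) = ᵗz A z` on `ℝⁿ`. -/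
noncomputable def quadForm {n : ℕ} (A : Matrix (Fin n) (Fin n) ℝ) :
    QuadraticForm ℝ (Fin n → ℝ) :=
  A.toQuadraticForm'

/-- `quadForm A` is the function `z ↦ ᵗz A z`. -/
theorem quadForm_apply {n : ℕ} (A : Matrix (Fin n) (Fin n) ℝ) (z : Fin n → ℝ) :
    quadForm A z = z ⬝ᵥ A *ᵥ z := by
  simp [quadForm, Matrix.toQuadraticForm', Matrix.toLinearMap₂'_apply']

/-- `A` has signature `(k, l)`: `k` is the positive and `l` the negative index of inertia
of `Q_A`. The matrix may be degenerate. -/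
def HasSignature {n : ℕ} (A : Matrix (Fin n) (Fin n) ℝ) (k l : ℕ) : Prop :=
  sigPos (quadForm A) = k ∧ sigNeg (quadForm A) = l

/-- `A ∈ W` has maximal rank in `W`. -/
def HasMaximalRankIn {n : ℕ} (A : Matrix (Fin n) (Fin n) ℝ)
    (W : Submodule ℝ (Matrix (Fin n) (Fin n) ℝ)) : Prop :=
  A ∈ W ∧ ∀ F ∈ W, F.rank ≤ A.rank

/-- The sublevel set `Γ_A^r = {Q_A ≤ r}`. -/
def Gam {n : ℕ} (r : ℝ) (A : Matrix (Fin n) (Fin n) ℝ) : Set (Fin n → ℝ) :=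
  {z | quadForm A z ≤ r}

/-- `∂Γ_A^r` is a variety of dimension `n - 1`: it contains a point `z` with `A z ≠ 0`
(near such a point it is an analytic hypersurface with normal vector `A z`). -/
def BoundaryIsHypersurface {n : ℕ} (r : ℝ) (A : Matrix (Fin n) (Fin n) ℝ) : Prop :=
  ∃ z ∈ frontier (Gam r A), A *ᵥ z ≠ 0

/-- `∂Γ_A^r` and `∂Γ_B^r` intersect transversally at `z`: `z` lies on both boundaries, and the
normal vectors `A z` and `B z` are linearly independent. -/
def IntersectTransversallyAt {n : ℕ} (r : ℝ) (A B : Matrix (Fin n) (Fin n) ℝ)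
    (z : Fin n → ℝ) : Prop :=
  z ∈ frontier (Gam r A) ∩ frontier (Gam r B) ∧ LinearIndependent ℝ ![A *ᵥ z, B *ᵥ z]

/-! If the boundaries are nowhere transversal, then `A z` and `B z` are dependent at every common
point `z` of the level sets (`TangentAlongLevel`). For `r > 0`, suppose `B - A` changes sign on the
positive cone of `A`. Some zero `z` of it there can be scaled to level `r`, where equal values turn
dependence into `A z = B z`; so `z` lies in the radical of `B - A`, which `sub_sign` refutes. Two
failing inclusions would then make the forms agree near a common positive vector, hence everywhere.
For `r = 0`, the point is that `B` has constant sign on the null cone of `A` (`not_sign_change`). A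
sign change on a null conic would give a quartic with a simple zero, i.e. a transversal
intersection; `k ≥ 2` supplies the conic and maximal rank excludes sign changes on the kernel of
`A`. The constant sign lets one compare `B / A` on the two sides of the cone
(`mul_le_mul_of_nonpos_on_null`). Closeness of `B` to `A` only preserves one positive and one
negative vector. -/

open Filter Topology

/-! ### Zeros of real quartics -/

/-- A real quartic with positive leading and negative constant coefficient has a positive zero. -/
theorem exists_pos_root_quartic (a₀ a₁ a₂ a₃ a₄ : ℝ) (h₄ : 0 < a₄) (h₀ : a₀ < 0) :
    ∃ x : ℝ, 0 < x ∧ a₄ * x ^ 4 + a₃ * x ^ 3 + a₂ * x ^ 2 + a₁ * x + a₀ = 0 := by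
  set f : ℝ → ℝ := fun x => a₄ * x ^ 4 + a₃ * x ^ 3 + a₂ * x ^ 2 + a₁ * x + a₀ with hf
  set S : ℝ := |a₃| + |a₂| + |a₁| + |a₀| with hS
  have hS0 : 0 ≤ S := by positivity
  set M : ℝ := 1 + S / a₄ with hM
  have hM1 : 1 ≤ M := by
    have : 0 ≤ S / a₄ := by positivity
    linarith
  have hM0 : 0 < M := by linarith
  -- Cauchy's root bound: `M ≥ 1` bounds each lower term by `|aᵢ| * M ^ 3`, and `a₄ * M ^ 4` exceeds
  -- their sum `S * M ^ 3`.
  have haM : a₄ * M = a₄ + S := by rw [hM]; field_simp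
  have p2 : M ^ 2 ≤ M ^ 3 := pow_le_pow_right₀ hM1 (by norm_num)
  have p1 : M ≤ M ^ 3 := by simpa using pow_le_pow_right₀ hM1 (show 1 ≤ 3 by norm_num)
  have p0 : 1 ≤ M ^ 3 := one_le_pow₀ hM1
  have e3 : -(|a₃| * M ^ 3) ≤ a₃ * M ^ 3 := by
    nlinarith [neg_abs_le a₃]
  have e2 : -(|a₂| * M ^ 3) ≤ a₂ * M ^ 2 := by
    nlinarith [neg_abs_le a₂, abs_nonneg a₂, sq_nonneg M]
  have e1 : -(|a₁| * M ^ 3) ≤ a₁ * M := by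
    nlinarith [neg_abs_le a₁, abs_nonneg a₁]
  have e0 : -(|a₀| * M ^ 3) ≤ a₀ := by
    nlinarith [neg_abs_le a₀, abs_nonneg a₀]
  have hfM : 0 < f M := by
    have : a₄ * M ^ 4 = a₄ * M ^ 3 + S * M ^ 3 := by
      linear_combination M ^ 3 * haM
    have h5 : 0 < a₄ * M ^ 3 := by positivity
    have h6 : S * M ^ 3 = |a₃| * M ^ 3 + |a₂| * M ^ 3 + |a₁| * M ^ 3 + |a₀| * M ^ 3 := by
      rw [hS]; ring
    simp only [hf]
    linarith
  have hf0 : f 0 < 0 := by simpa [hf] using h₀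
  have hc : ContinuousOn f (Set.Icc 0 M) := by
    apply Continuous.continuousOn
    fun_prop
  obtain ⟨x, hx, hx0⟩ := intermediate_value_Ioo hM0.le hc (show (0 : ℝ) ∈ Set.Ioo (f 0) (f M) from
    ⟨hf0, hfM⟩)
  exact ⟨x, hx.1, hx0⟩

/-- A real quartic with positive leading and negative constant coefficient has a simple zero. -/
theorem exists_simple_root_quartic (a₀ a₁ a₂ a₃ a₄ : ℝ) (h₄ : 0 < a₄) (h₀ : a₀ < 0) :
    ∃ x : ℝ, a₄ * x ^ 4 + a₃ * x ^ 3 + a₂ * x ^ 2 + a₁ * x + a₀ = 0 ∧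
      4 * a₄ * x ^ 3 + 3 * a₃ * x ^ 2 + 2 * a₂ * x + a₁ ≠ 0 := by
  by_contra! H
  obtain ⟨p, hp, hp0⟩ := exists_pos_root_quartic a₀ a₁ a₂ a₃ a₄ h₄ h₀
  obtain ⟨q', hq', hq0'⟩ := exists_pos_root_quartic a₀ (-a₁) a₂ (-a₃) a₄ h₄ h₀
  obtain ⟨q, hq⟩ : ∃ q, q = -q' := ⟨_, rfl⟩
  have hq0 : a₄ * q ^ 4 + a₃ * q ^ 3 + a₂ * q ^ 2 + a₁ * q + a₀ = 0 := by
    rw [hq]; linear_combination hq0'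
  have hdp := H p hp0
  have hdq := H q hq0
  have hpq : q - p ≠ 0 := by
    have : q - p < 0 := by linarith
    exact this.ne
  -- With `p > 0 > q` both double, the quartic must be `a₄ (x - p)² (x - q)²`, whose constant term
  -- is nonnegative. `E1`–`E6` recover its coefficients by divided differences.
  have E1 : a₄ * (q ^ 2 + 2 * q * p + 3 * p ^ 2) + a₃ * (q + 2 * p) + a₂ = 0 := by
    have : (q - p) ^ 2 *
        (a₄ * (q ^ 2 + 2 * q * p + 3 * p ^ 2) + a₃ * (q + 2 * p) + a₂) = 0 := by
      linear_combination hq0 - hp0 - (q - p) * hdp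
    exact (mul_eq_zero.1 this).resolve_left (pow_ne_zero 2 hpq)
  have E2 : 4 * a₄ * (q ^ 2 + q * p + p ^ 2) + 3 * a₃ * (q + p) + 2 * a₂ = 0 := by
    have : (q - p) * (4 * a₄ * (q ^ 2 + q * p + p ^ 2) + 3 * a₃ * (q + p) + 2 * a₂) = 0 := by
      linear_combination hdq - hdp
    exact (mul_eq_zero.1 this).resolve_left hpq
  have E3 : a₃ = -2 * a₄ * (p + q) := by
    have : (q - p) * (a₃ + 2 * a₄ * (p + q)) = 0 := by
      linear_combination E2 - 2 * E1
    linarith [(mul_eq_zero.1 this).resolve_left hpq]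
  subst E3
  have E4 : a₂ = a₄ * (p ^ 2 + q ^ 2 + 4 * p * q) := by linear_combination E1
  subst E4
  have E5 : a₁ = -2 * a₄ * p * q * (p + q) := by linear_combination hdp
  subst E5
  have E6 : a₀ = a₄ * (p * q) ^ 2 := by linear_combination hp0
  have : 0 ≤ a₄ * (p * q) ^ 2 := by positivity
  linarith

/-! ### Tangency of level sets of symmetric bilinear forms -/

section BilinForm

variable {E : Type*} [AddCommGroup E] [Module ℝ E]

/-- At every common point `z` of the level sets `A z z = r` and `B z z = r`, the functionals
`A z` and `B z` are linearly dependent. -/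
def TangentAlongLevel (r : ℝ) (A B : LinearMap.BilinForm ℝ E) : Prop :=
  ∀ z, A z z = r → B z z = r → ∃ a b : ℝ, (a ≠ 0 ∨ b ≠ 0) ∧ ∀ w, a * A z w + b * B z w = 0

theorem TangentAlongLevel.symm {r : ℝ} {A B : LinearMap.BilinForm ℝ E}
    (h : TangentAlongLevel r A B) : TangentAlongLevel r B A := by
  intro z hB hA
  obtain ⟨a, b, hab, hw⟩ := h z hA hB
  exact ⟨b, a, hab.symm, fun w => by linarith [hw w]⟩

/-- `B - A` does not change sign on the positive cone of `A`. -/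
theorem TangentAlongLevel.sub_sign {r : ℝ} (hr : 0 < r) {A B : LinearMap.BilinForm ℝ E}
    (hA : ∀ x y, A x y = A y x) (hB : ∀ x y, B x y = B y x) (h : TangentAlongLevel r A B)
    {u v : E} (hu : 0 < A u u) (hv : 0 < A v v) (hu' : A u u < B u u) : A v v ≤ B v v := by
  by_contra! hv'
  -- This sign keeps `A` positive on the whole segment from `u` to `v`.
  wlog huv : 0 ≤ A u v generalizing v
  · refine this (v := -v) (by simpa using hv) (by simpa using hv') ?_
    simp only [map_neg]
    linarith
  set z : ℝ → E := fun t => (1 - t) • u + t • v with hz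
  have hAz : ∀ t, A (z t) (z t) = (1 - t) ^ 2 * A u u + 2 * t * (1 - t) * A u v
      + t ^ 2 * A v v := by
    intro t
    simp only [hz, map_add, map_smul, LinearMap.add_apply, LinearMap.smul_apply, smul_eq_mul,
      hA v u]
    ring
  have hBz : ∀ t, B (z t) (z t) = (1 - t) ^ 2 * B u u + 2 * t * (1 - t) * B u v
      + t ^ 2 * B v v := by
    intro t
    simp only [hz, map_add, map_smul, LinearMap.add_apply, LinearMap.smul_apply, smul_eq_mul,
      hB v u]
    ring
  have hcont : ContinuousOn (fun t => A (z t) (z t) - B (z t) (z t)) (Set.Icc 0 1) := by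
    simp only [hAz, hBz]
    apply Continuous.continuousOn
    fun_prop
  obtain ⟨t, ⟨ht0, ht1⟩, ht⟩ := intermediate_value_Ioo zero_le_one hcont
    (show (0 : ℝ) ∈ _ from ⟨by simp [hz]; linarith, by simp [hz]; linarith⟩)
  have hAB : A (z t) (z t) = B (z t) (z t) := by simpa [sub_eq_zero] using ht
  have hpos : 0 < A (z t) (z t) := by
    rw [hAz]
    have h1 : 0 < 1 - t := by linarith
    have : 0 < (1 - t) ^ 2 * A u u := by positivity
    have : 0 ≤ 2 * t * (1 - t) * A u v := by positivity
    have : 0 ≤ t ^ 2 * A v v := by positivity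
    linarith
  set s : ℝ := Real.sqrt (r / A (z t) (z t)) with hs
  have hs2 : s ^ 2 * A (z t) (z t) = r := by
    rw [hs, Real.sq_sqrt (by positivity)]
    field_simp
  have hs0 : s ≠ 0 := by
    rintro h0
    rw [h0] at hs2
    linarith
  obtain ⟨a, b, hab, hw⟩ := h (s • z t)
    (by simp only [map_smul, LinearMap.smul_apply, smul_eq_mul]; linarith)
    (by simp only [map_smul, LinearMap.smul_apply, smul_eq_mul, ← hAB]; linarith)
  simp only [map_smul, LinearMap.smul_apply, smul_eq_mul] at hw
  have hba : b = -a := by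
    have := hw (s • z t)
    simp only [map_smul, smul_eq_mul, ← hAB] at this
    have h2 : (a + b) * r = 0 := by rw [← hs2]; linear_combination this
    linarith [(mul_eq_zero.1 h2).resolve_right hr.ne']
  have ha : a ≠ 0 := by
    rintro rfl
    simp [hba] at hab
  have hD : ∀ w, A (z t) w = B (z t) w := by
    intro w
    have h1 := hw w
    rw [hba] at h1
    have : (a * s) * (A (z t) w - B (z t) w) = 0 := by linear_combination h1
    linarith [(mul_eq_zero.1 this).resolve_left (mul_ne_zero ha hs0)]
  have h1 := hD u
  have h2 := hD v
  simp only [hz, map_add, map_smul, LinearMap.add_apply, LinearMap.smul_apply, smul_eq_mul,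
    hA v u, hB v u] at h1 h2
  -- With `D = B - A`, eliminate `D u v` from `D (z t) u = 0` and `D (z t) v = 0`.
  have h3 : (1 - t) ^ 2 * (B u u - A u u) = t ^ 2 * (B v v - A v v) := by
    linear_combination t * h2 - (1 - t) * h1
  have h4 : 0 < (1 - t) ^ 2 * (B u u - A u u) :=
    mul_pos (pow_pos (by linarith) 2) (by linarith)
  have h5 : t ^ 2 * (B v v - A v v) < 0 :=
    mul_neg_of_pos_of_neg (pow_pos ht0 2) (by linarith)
  linarith

/-- Sublevel sets at a positive level whose boundaries are nowhere transversal are nested. -/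
theorem TangentAlongLevel.sublevel_subset_of_pos {r : ℝ} (hr : 0 < r)
    {A B : LinearMap.BilinForm ℝ E}
    (hA : ∀ x y, A x y = A y x) (hB : ∀ x y, B x y = B y x) (h : TangentAlongLevel r A B)
    {p : E} (hAp : 0 < A p p) (hBp : 0 < B p p) :
    {z | A z z ≤ r} ⊆ {z | B z z ≤ r} ∨ {z | B z z ≤ r} ⊆ {z | A z z ≤ r} := by
  by_contra! H
  obtain ⟨H1, H2⟩ := H
  obtain ⟨u, hu1, hu2⟩ := Set.not_subset.1 H1
  obtain ⟨v, hv1, hv2⟩ := Set.not_subset.1 H2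
  simp only [Set.mem_ofPred_eq, not_le] at hu1 hu2 hv1 hv2
  -- `A ≤ B` on the positive cone of `B`, and `B ≤ A` on that of `A`
  have hBpos : ∀ x, 0 < B x x → A x x ≤ B x x := by
    intro x hx
    by_contra! hlt
    have := h.symm.sub_sign hr hB hA hx (by linarith : 0 < B u u) hlt
    linarith
  have hApos : ∀ x, 0 < A x x → B x x ≤ A x x := by
    intro x hx
    by_contra! hlt
    have := h.sub_sign hr hA hB hx (by linarith : 0 < A v v) hlt
    linarith
  have key : ∀ᶠ e : ℝ in 𝓝 0, A (p + e • u) (p + e • u) = B (p + e • u) (p + e • u) := by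
    have eA : ∀ e : ℝ, A (p + e • u) (p + e • u) = A p p + 2 * e * A p u + e ^ 2 * A u u := by
      intro e
      simp only [map_add, map_smul, LinearMap.add_apply, LinearMap.smul_apply, smul_eq_mul, hA u p]
      ring
    have eB : ∀ e : ℝ, B (p + e • u) (p + e • u) = B p p + 2 * e * B p u + e ^ 2 * B u u := by
      intro e
      simp only [map_add, map_smul, LinearMap.add_apply, LinearMap.smul_apply, smul_eq_mul, hB u p]
      ring
    have cA : ∀ᶠ e : ℝ in 𝓝 0, 0 < A (p + e • u) (p + e • u) := by
      simp only [eA]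
      refine (show Continuous fun e : ℝ => A p p + 2 * e * A p u + e ^ 2 * A u u by
        fun_prop).continuousAt.eventually_const_lt ?_
      simpa using hAp
    have cB : ∀ᶠ e : ℝ in 𝓝 0, 0 < B (p + e • u) (p + e • u) := by
      simp only [eB]
      refine (show Continuous fun e : ℝ => B p p + 2 * e * B p u + e ^ 2 * B u u by
        fun_prop).continuousAt.eventually_const_lt ?_
      simpa using hBp
    filter_upwards [cA, cB] with e h1 h2
    exact le_antisymm (hBpos _ h2) (hApos _ h1)
  obtain ⟨d, hd, hball⟩ := Metric.eventually_nhds_iff.1 key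
  have k0 := hball (y := 0) (by simpa using hd)
  have k1 := hball (y := d / 2) (by rw [dist_zero_right, Real.norm_eq_abs, abs_of_pos] <;> linarith)
  have k2 := hball (y := -(d / 2))
    (by rw [dist_zero_right, norm_neg, Real.norm_eq_abs, abs_of_pos] <;> linarith)
  simp only [map_add, map_smul, LinearMap.add_apply, LinearMap.smul_apply, smul_eq_mul,
    hA u p, hB u p] at k0 k1 k2
  -- The second difference in `e` isolates the `u u` coefficient.
  have : d ^ 2 * (A u u - B u u) = 0 := by linear_combination 2 * k1 + 2 * k2 - 4 * k0
  have := (mul_eq_zero.1 this).resolve_left (by positivity)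
  linarith

/-- Two null vectors of `A` that are not `A`-orthogonal cannot be separated by the sign of `B`:
together with an orthogonal positive vector they span a space of signature `(2, 1)`, in which
`B` restricted to the null conic is a quartic. -/
theorem TangentAlongLevel.not_sign_change_of_ne {A B : LinearMap.BilinForm ℝ E}
    (hA : ∀ x y, A x y = A y x) (hB : ∀ x y, B x y = B y x) (h : TangentAlongLevel 0 A B)
    (hpos : ∀ u, ∃ y, 0 < A y y ∧ A y u = 0) {u v : E} (hu : A u u = 0) (hv : A v v = 0)
    (huv : A u v ≠ 0) (hBu : 0 < B u u) (hBv : B v v < 0) : False := by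
  obtain ⟨y, hyu, hyv, hy⟩ : ∃ y, A u y = 0 ∧ A v y = 0 ∧ 0 < A y y := by
    obtain ⟨y, hy, hyu⟩ := hpos u
    -- Since `u` is null and orthogonal to `y`, this shift leaves `A y y` unchanged.
    refine ⟨y - (A y v / A u v) • u, ?_, ?_, ?_⟩
    · simp [hA u y, hyu, hu]
    · simp only [map_sub, map_smul, smul_eq_mul, hA v u, hA v y]
      field_simp
      ring
    · simp only [map_sub, map_smul, LinearMap.sub_apply, LinearMap.smul_apply, smul_eq_mul,
        hA u y, hyu, hu]
      simpa using hy
  set κ : ℝ := -A y y / (2 * A u v) with hκ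
  have hκ0 : κ ≠ 0 := div_ne_zero (neg_ne_zero.2 hy.ne') (mul_ne_zero two_ne_zero huv)
  have hκ1 : 2 * κ * A u v + A y y = 0 := by rw [hκ]; field_simp; ring
  obtain ⟨x, hx0, hx1⟩ := exists_simple_root_quartic (κ ^ 2 * B v v) (2 * κ * B v y)
    (B y y + 2 * κ * B u v) (2 * B u y) (B u u) hBu
    (mul_neg_of_pos_of_neg (by positivity) hBv)
  have hzA : A (x ^ 2 • u + x • y + κ • v) (x ^ 2 • u + x • y + κ • v) = 0 := by
    simp only [map_add, map_smul, LinearMap.add_apply, LinearMap.smul_apply, smul_eq_mul,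
      hA v u, hA y u, hA y v, hyu, hyv, hu, hv]
    linear_combination x ^ 2 * hκ1
  have hzB : B (x ^ 2 • u + x • y + κ • v) (x ^ 2 • u + x • y + κ • v) = 0 := by
    simp only [map_add, map_smul, LinearMap.add_apply, LinearMap.smul_apply, smul_eq_mul,
      hB v u, hB y u, hB y v]
    linear_combination hx0
  obtain ⟨a, b, hab, hw⟩ := h _ hzA hzB
  -- The velocity of the conic `x ↦ x² u + x y + κ v`: `A z` kills it, while `B z` takes half the
  -- derivative of the quartic, nonzero at a simple zero. Hence `b = 0`; pairing with `u` then gives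
  -- `a = 0`.
  have h1 := hw ((2 * x) • u + y)
  have h2 := hw u
  simp only [map_add, map_smul, LinearMap.add_apply, LinearMap.smul_apply, smul_eq_mul,
    hA v u, hA y u, hyu, hyv, hu, hB v u, hB y u] at h1 h2
  have hb : b = 0 := by
    have : b * (4 * B u u * x ^ 3 + 3 * (2 * B u y) * x ^ 2 + 2 * (B y y + 2 * κ * B u v) * x
        + 2 * κ * B v y) = 0 := by
      linear_combination 2 * h1 - 2 * a * x * hκ1
    exact (mul_eq_zero.1 this).resolve_right hx1
  have ha : a = 0 := by
    have : a * (κ * A u v) = 0 := by rw [hb] at h2; linear_combination h2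
    exact (mul_eq_zero.1 this).resolve_right (mul_ne_zero hκ0 huv)
  simp [ha, hb] at hab

/-- Two nonzero linear functionals are simultaneously nonzero somewhere. -/
theorem exists_ne_zero_and_ne_zero {f g : E →ₗ[ℝ] ℝ} (hf : f ≠ 0) (hg : g ≠ 0) :
    ∃ x, f x ≠ 0 ∧ g x ≠ 0 := by
  obtain ⟨x, hx⟩ := DFunLike.ne_iff.1 hf
  obtain ⟨y, hy⟩ := DFunLike.ne_iff.1 hg
  simp only [LinearMap.zero_apply] at hx hy
  by_cases hgx : g x = 0
  · by_cases hfy : f y = 0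
    · exact ⟨x + y, by simpa [hfy] using hx, by simpa [hgx] using hy⟩
    · exact ⟨y, hfy, hy⟩
  · exact ⟨x, hx, hgx⟩

/-- `B` does not change sign on the null cone of `A`. -/
theorem TangentAlongLevel.not_sign_change {A B : LinearMap.BilinForm ℝ E}
    (hA : ∀ x y, A x y = A y x) (hB : ∀ x y, B x y = B y x) (h : TangentAlongLevel 0 A B)
    (hpos : ∀ u, ∃ y, 0 < A y y ∧ A y u = 0) (hker : ∀ u, A u = 0 → B u u = 0)
    {u v : E} (hu : A u u = 0) (hv : A v v = 0)
    (hBu : 0 < B u u) (hBv : B v v < 0) : False := by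
  by_cases huv : A u v = 0
  swap
  · exact h.not_sign_change_of_ne hA hB hpos hu hv huv hBu hBv
  obtain ⟨x, hxu, hxv⟩ := exists_ne_zero_and_ne_zero (f := A u) (g := A v)
    (fun h0 => hBu.ne' (hker u h0)) (fun h0 => hBv.ne (hker v h0))
  obtain ⟨y, hy, hyu⟩ := hpos u
  -- reflections of `u` approaching `u`
  set q : ℝ → ℝ := fun e => A y y + 2 * e * A y x + e ^ 2 * A x x with hq
  set w : ℝ → E := fun e => q e • u - (2 * e * A u x) • (y + e • x) with hw
  have hwA : ∀ e, A (w e) (w e) = 0 := by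
    intro e
    simp only [hw, hq, map_add, map_sub, map_smul, LinearMap.add_apply, LinearMap.sub_apply,
      LinearMap.smul_apply, smul_eq_mul, hu, hA u y, hA x u, hA x y, hyu]
    ring
  have hwB : ∀ᶠ e in 𝓝 0, 0 < B (w e) (w e) := by
    have : Continuous fun e => B (w e) (w e) := by
      simp only [hw, hq, map_add, map_sub, map_smul, LinearMap.add_apply, LinearMap.sub_apply,
        LinearMap.smul_apply, smul_eq_mul]
      fun_prop
    refine this.continuousAt.eventually_const_lt ?_
    simp only [hw, hq]
    simpa using mul_pos hy (mul_pos hy hBu)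
  have hwv : ∀ e, A (w e) v = -(2 * e * A u x) * (A v y + e * A v x) := by
    intro e
    simp only [hw, map_add, map_sub, map_smul, LinearMap.add_apply, LinearMap.sub_apply,
      LinearMap.smul_apply, smul_eq_mul, huv, hA y v, hA x v]
    ring
  obtain ⟨d, hd, hball⟩ := Metric.eventually_nhds_iff.1 hwB
  -- The reflected `w e` is null and `B`-positive for small `e`, so the non-orthogonal case forces
  -- `A (w e) v = 0`. An affine function of `e` vanishing at two points then gives `A v x = 0`.
  have hgood : ∀ e, 0 < e → e < d → A v y + e * A v x = 0 := by
    intro e he hed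
    by_contra hne
    refine h.not_sign_change_of_ne hA hB hpos (hwA e) hv ?_ (hball ?_) hBv
    · rw [hwv]
      exact mul_ne_zero (neg_ne_zero.2 (mul_ne_zero (by positivity) hxu)) hne
    · rwa [dist_zero_right, Real.norm_eq_abs, abs_of_pos he]
  have g1 := hgood (d / 2) (by linarith) (by linarith)
  have g2 := hgood (d / 3) (by linarith) (by linarith)
  have : d * A v x = 0 := by linear_combination 6 * g1 - 6 * g2
  exact mul_ne_zero hd.ne' hxv this

/-- If `B ≤ 0` on the null cone of `A`, then the ratio `B / A` on the negative cone of `A`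
dominates that on the positive cone. -/
theorem mul_le_mul_of_nonpos_on_null {A B : LinearMap.BilinForm ℝ E}
    (hA : ∀ x y, A x y = A y x) (hB : ∀ x y, B x y = B y x)
    (h : ∀ z, A z z = 0 → B z z ≤ 0) {x y : E} (hx : 0 < A x x) (hy : A y y < 0) :
    A x x * B y y ≤ A y y * B x x := by
  set a := A x x with ha
  set b := A x y with hb
  set c := A y y with hc
  have hac : 0 < -(a * c) := by nlinarith
  set s := Real.sqrt (b ^ 2 - a * c) with hs
  have hs2 : s ^ 2 = b ^ 2 - a * c := Real.sq_sqrt (by nlinarith [sq_nonneg b])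
  have hs0 : 0 < s := Real.sqrt_pos.2 (by nlinarith [sq_nonneg b])
  have hbs : |b| < s := abs_lt_of_sq_lt_sq (by linarith) hs0.le
  obtain ⟨hb1, hb2⟩ := abs_lt.1 hbs
  -- The two null lines of `A` in the plane of `x` and `y`. Weights `s + b` and `s - b`, both
  -- positive, cancel the `B x y` terms.
  have h1 := h (c • x + (s - b) • y) (by
    simp only [map_add, map_smul, LinearMap.add_apply, LinearMap.smul_apply, smul_eq_mul,
      hA y x, ← ha, ← hb, ← hc]
    linear_combination c * hs2)
  have h2 := h (c • x + (-s - b) • y) (by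
    simp only [map_add, map_smul, LinearMap.add_apply, LinearMap.smul_apply, smul_eq_mul,
      hA y x, ← ha, ← hb, ← hc]
    linear_combination c * hs2)
  simp only [map_add, map_smul, LinearMap.add_apply, LinearMap.smul_apply, smul_eq_mul,
    hB y x] at h1 h2
  have h3 := mul_nonpos_of_nonneg_of_nonpos (by linarith : 0 ≤ s + b) h1
  have h4 := mul_nonpos_of_nonneg_of_nonpos (by linarith : 0 ≤ s - b) h2
  have h5 : (2 * s * c) * (c * B x x - a * B y y) ≤ 0 := by
    have : (2 * s * c) * (c * B x x - a * B y y) =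
        (s + b) * (c * (c * B x x) + c * ((s - b) * B x y) +
          ((s - b) * (c * B x y) + (s - b) * ((s - b) * B y y))) +
        (s - b) * (c * (c * B x x) + c * ((-s - b) * B x y) +
          ((-s - b) * (c * B x y) + (-s - b) * ((-s - b) * B y y))) := by
      linear_combination -2 * s * B y y * hs2
    rw [this]
    refine le_trans (le_of_eq ?_) (add_nonpos h3 h4)
    ring
  by_contra! hlt
  have h6 : 2 * s * c < 0 := by nlinarith
  have := mul_pos_of_neg_of_neg h6 (by linarith : c * B x x - a * B y y < 0)
  linarith

/-- Null sublevel sets whose boundaries are nowhere transversal are nested. -/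
theorem TangentAlongLevel.sublevel_zero_subset {A B : LinearMap.BilinForm ℝ E}
    (hA : ∀ x y, A x y = A y x) (hB : ∀ x y, B x y = B y x) (h : TangentAlongLevel 0 A B)
    (hpos : ∀ u, ∃ y, 0 < A y y ∧ A y u = 0) (hker : ∀ u, A u = 0 → B u u = 0)
    {p q : E} (hAp : 0 < A p p) (hBp : 0 < B p p) (hAq : A q q < 0) (hBq : B q q < 0) :
    {z | A z z ≤ 0} ⊆ {z | B z z ≤ 0} ∨ {z | B z z ≤ 0} ⊆ {z | A z z ≤ 0} := by
  by_cases hn : ∀ z, A z z = 0 → B z z ≤ 0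
  · left
    intro z hz
    simp only [Set.mem_ofPred_eq] at hz ⊢
    rcases hz.lt_or_eq with hz | hz
    · have := mul_le_mul_of_nonpos_on_null hA hB hn hAp hz
      have h2 : A z z * B p p < 0 := mul_neg_of_neg_of_pos hz hBp
      by_contra! hlt
      have := mul_pos hAp hlt
      linarith
    · exact hn z hz
  · right
    push Not at hn
    obtain ⟨u, hu, hBu⟩ := hn
    have hn' : ∀ z, A z z = 0 → (-B) z z ≤ 0 := by
      intro z hz
      by_contra! hlt
      exact h.not_sign_change hA hB hpos hker hu hz hBu (by simpa using hlt)
    intro z hz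
    simp only [Set.mem_ofPred_eq] at hz ⊢
    by_contra! hlt
    have h1 := mul_le_mul_of_nonpos_on_null hA (B := -B) (fun x y => by simp [hB x y]) hn' hlt hAq
    simp only [LinearMap.neg_apply] at h1
    have h2 := mul_neg_of_pos_of_neg hlt hBq
    have h3 := mul_nonneg_of_nonpos_of_nonpos hAq.le hz
    linarith

end BilinForm

/-! ### From matrices to bilinear forms -/

section Matrices

variable {n : ℕ}

/-- A maximal-rank element of a space of symmetric matrices: every form of the space vanishes on
its kernel. -/
theorem HasMaximalRankIn.dotProduct_mulVec_eq_zero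
    {W : Submodule ℝ (Matrix (Fin n) (Fin n) ℝ)} {A B : Matrix (Fin n) (Fin n) ℝ}
    (hA : HasMaximalRankIn A W) (hsym : A.IsSymm) (hB : B ∈ W) {u : Fin n → ℝ}
    (hu : A *ᵥ u = 0) : u ⬝ᵥ B *ᵥ u = 0 := by
  by_contra hne
  let b := Module.finBasis ℝ (LinearMap.range A.mulVecLin)
  have hx : ∀ i, ∃ x, A *ᵥ x = b i := fun i => LinearMap.mem_range.1 (b i).2
  choose x hx using hx
  -- A family in the range of `A + t B` for `t ≠ 0`, since `(A + t B)(t⁻¹ u) = B u`. It is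
  -- independent at `t = 0` because the range of `A` is orthogonal to `u`, and independence is open;
  -- so the rank would exceed that of `A`.
  let y : ℝ → Fin (Module.finrank ℝ (LinearMap.range A.mulVecLin) + 1) → Fin n → ℝ :=
    fun t => Fin.cons (B *ᵥ u) (fun i => (A + t • B) *ᵥ x i)
  have hy0 : LinearIndependent ℝ (y 0) := by
    refine linearIndependent_finCons.2 ⟨?_, ?_⟩
    · have := b.linearIndependent.map' (LinearMap.range A.mulVecLin).subtype
        (Submodule.ker_subtype _)
      have he : (fun i => (A + (0 : ℝ) • B) *ᵥ x i) =
          (LinearMap.range A.mulVecLin).subtype ∘ b := by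
        funext i
        simp [hx]
      exact he ▸ this
    · intro hmem
      have hle : Submodule.span ℝ (Set.range fun i => (A + (0 : ℝ) • B) *ᵥ x i) ≤
          LinearMap.range A.mulVecLin := by
        rw [Submodule.span_le]
        rintro _ ⟨i, rfl⟩
        exact ⟨x i, by simp⟩
      obtain ⟨z, hz⟩ := hle hmem
      apply hne
      rw [← hz, Matrix.mulVecLin_apply, Matrix.dotProduct_mulVec, ← Matrix.mulVec_transpose,
        hsym.eq, hu, zero_dotProduct]
  have hcont : Continuous y := by
    refine continuous_pi fun i => ?_
    refine Fin.cases ?_ (fun j => ?_) i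
    · simpa [y] using continuous_const
    · simp only [y, Fin.cons_succ, Matrix.add_mulVec, Matrix.smul_mulVec]
      fun_prop
  have hev : ∀ᶠ t in 𝓝 (0 : ℝ), LinearIndependent ℝ (y t) :=
    hcont.continuousAt.eventually_mem (isOpen_setOfPred_linearIndependent.mem_nhds hy0)
  obtain ⟨d, hd, hball⟩ := Metric.eventually_nhds_iff.1 hev
  have hd2 : d / 2 ≠ 0 := by positivity
  have hli := hball (y := d / 2)
    (by rw [dist_zero_right, Real.norm_eq_abs, abs_of_pos] <;> linarith)
  generalize d / 2 = t at hd2 hli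
  have hle : Submodule.span ℝ (Set.range (y t)) ≤
      LinearMap.range (A + t • B).mulVecLin := by
    rw [Submodule.span_le]
    rintro _ ⟨i, rfl⟩
    refine Fin.cases ?_ (fun j => ?_) i
    · refine ⟨t⁻¹ • u, ?_⟩
      simp [y, Matrix.add_mulVec, Matrix.smul_mulVec, hu, smul_smul, hd2]
    · exact ⟨x j, by simp only [y, Fin.cons_succ, Matrix.mulVecLin_apply]⟩
  have h1 := Submodule.finrank_mono hle
  rw [finrank_span_eq_card hli, Fintype.card_fin] at h1
  have h2 := hA.2 _ (W.add_mem hA.1 (W.smul_mem t hB))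
  rw [Matrix.rank, Matrix.rank] at h2
  exact absurd (h1.trans h2) (by simp)

theorem toBilin'_comm_of_isSymm {A : Matrix (Fin n) (Fin n) ℝ} (hA : A.IsSymm)
    (x y : Fin n → ℝ) : Matrix.toBilin' A x y = Matrix.toBilin' A y x := by
  rw [Matrix.toBilin'_apply', Matrix.toBilin'_apply', Matrix.dotProduct_mulVec,
    ← Matrix.mulVec_transpose, hA.eq, dotProduct_comm]

theorem quadForm_eq_toBilin' (A : Matrix (Fin n) (Fin n) ℝ) (z : Fin n → ℝ) :
    quadForm A z = Matrix.toBilin' A z z := by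
  rw [quadForm_apply, Matrix.toBilin'_apply']

theorem Gam_eq (r : ℝ) (A : Matrix (Fin n) (Fin n) ℝ) :
    Gam r A = {z | Matrix.toBilin' A z z ≤ r} := by
  ext z
  simp [Gam, quadForm_eq_toBilin']

/-- A form with positive index at least two has a positive vector orthogonal to any given one. -/
theorem exists_pos_orthogonal {A : Matrix (Fin n) (Fin n) ℝ}
    (h : 2 ≤ sigPos (quadForm A)) (u : Fin n → ℝ) :
    ∃ y, 0 < Matrix.toBilin' A y y ∧ Matrix.toBilin' A y u = 0 := by
  obtain ⟨V, hV, hVpos⟩ := exists_finrank_eq_sigPos_and_posDef (quadForm A)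
  have hlt : Module.finrank ℝ ℝ < Module.finrank ℝ V := by
    rw [hV, Module.finrank_self]
    omega
  obtain ⟨y, hy, hy0⟩ := Submodule.exists_mem_ne_zero_of_ne_bot
    (LinearMap.ker_ne_bot_of_finrank_lt (f := ((Matrix.toBilin' A).flip u).comp V.subtype) hlt)
  refine ⟨y, ?_, by simpa using hy⟩
  have := hVpos y hy0
  rwa [QuadraticMap.restrict_apply, quadForm_eq_toBilin'] at this

theorem toBilin'_add_smul_self {A : Matrix (Fin n) (Fin n) ℝ} (hA : A.IsSymm)
    (z p : Fin n → ℝ) (e : ℝ) :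
    Matrix.toBilin' A (z + e • p) (z + e • p) = Matrix.toBilin' A z z +
      2 * e * Matrix.toBilin' A z p + e ^ 2 * Matrix.toBilin' A p p := by
  simp only [map_add, map_smul, LinearMap.add_apply, LinearMap.smul_apply, smul_eq_mul,
    toBilin'_comm_of_isSymm hA p z]
  ring

theorem continuous_toBilin'_self (A : Matrix (Fin n) (Fin n) ℝ) :
    Continuous fun z => Matrix.toBilin' A z z := by
  simp only [Matrix.toBilin'_apply']
  fun_prop

/-- If `Q_A` is positive somewhere, the level set `{Q_A = r}`, `r ≥ 0`, is in the boundary of the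
sublevel set. -/
theorem mem_frontier_Gam {A : Matrix (Fin n) (Fin n) ℝ} (hA : A.IsSymm) {r : ℝ}
    {p : Fin n → ℝ} (hp : 0 < Matrix.toBilin' A p p) {z : Fin n → ℝ}
    (hz : Matrix.toBilin' A z z = r) : z ∈ frontier (Gam r A) := by
  wlog hzp : 0 ≤ Matrix.toBilin' A z p generalizing p
  · refine this (p := -p) (by simpa using hp) ?_
    simp only [map_neg]
    linarith
  have hcl : z ∈ Gam r A := by
    rw [Gam_eq]
    exact hz.le
  refine ⟨subset_closure hcl, fun hint => ?_⟩
  have hc : Continuous fun e : ℝ => z + e • p := by fun_prop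
  have hev : ∀ᶠ e in 𝓝 (0 : ℝ), z + e • p ∈ interior (Gam r A) :=
    hc.continuousAt.eventually_mem (isOpen_interior.mem_nhds (by simpa using hint))
  obtain ⟨d, hd, hball⟩ := Metric.eventually_nhds_iff.1 hev
  have h1 := interior_subset (hball (y := d / 2)
    (by rw [dist_zero_right, Real.norm_eq_abs, abs_of_pos] <;> linarith))
  rw [Gam_eq, Set.mem_ofPred_eq, toBilin'_add_smul_self hA, hz] at h1
  have h2 : 0 ≤ 2 * (d / 2) * Matrix.toBilin' A z p := by positivity
  have h3 : 0 < (d / 2) ^ 2 * Matrix.toBilin' A p p := by positivity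
  linarith

theorem toBilin'_self_eq_of_mem_frontier {A : Matrix (Fin n) (Fin n) ℝ} {r : ℝ}
    {z : Fin n → ℝ} (hz : z ∈ frontier (Gam r A)) : Matrix.toBilin' A z z = r := by
  rw [Gam_eq] at hz
  exact frontier_le_subset_eq (continuous_toBilin'_self A) continuous_const hz

/-- If `{Q_A = 0}` has a regular point, then `Q_A` takes negative values. -/
theorem exists_neg_of_boundaryIsHypersurface {A : Matrix (Fin n) (Fin n) ℝ} (hA : A.IsSymm)
    (h : BoundaryIsHypersurface 0 A) : ∃ q, Matrix.toBilin' A q q < 0 := by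
  obtain ⟨z, hz, hAz⟩ := h
  by_contra! hnn
  have hz0 := toBilin'_self_eq_of_mem_frontier hz
  apply hAz
  set w := A *ᵥ z with hw
  have hzw : Matrix.toBilin' A z w = w ⬝ᵥ w := by
    rw [toBilin'_comm_of_isSymm hA, Matrix.toBilin'_apply']
  -- Cauchy–Schwarz for a semidefinite form: a null vector lies in the kernel.
  have hq : ∀ e : ℝ, 0 ≤ Matrix.toBilin' A w w * (e * e) + 2 * (w ⬝ᵥ w) * e + 0 := by
    intro e
    have := hnn (z + e • w)
    rw [toBilin'_add_smul_self hA, hz0, hzw] at this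
    linarith
  have := discrim_le_zero hq
  rw [discrim] at this
  have h0 : w ⬝ᵥ w = 0 := by nlinarith [sq_nonneg (w ⬝ᵥ w)]
  exact dotProduct_self_eq_zero.1 h0

/-- Absence of transversal intersection points, in terms of bilinear forms. -/
theorem tangentAlongLevel_of_not_intersectTransversally {A B : Matrix (Fin n) (Fin n) ℝ}
    (hA : A.IsSymm) (hB : B.IsSymm) {r : ℝ} {p : Fin n → ℝ}
    (hAp : 0 < Matrix.toBilin' A p p) (hBp : 0 < Matrix.toBilin' B p p)
    (h : ¬ ∃ z, IntersectTransversallyAt r A B z) :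
    TangentAlongLevel r (Matrix.toBilin' A) (Matrix.toBilin' B) := by
  intro z hzA hzB
  have hdep : ¬ LinearIndependent ℝ ![A *ᵥ z, B *ᵥ z] := fun hli =>
    h ⟨z, ⟨mem_frontier_Gam hA hAp hzA, mem_frontier_Gam hB hBp hzB⟩, hli⟩
  rw [LinearIndependent.pair_iff] at hdep
  push Not at hdep
  obtain ⟨a, b, hab, hne⟩ := hdep
  refine ⟨a, b, ?_, fun w => ?_⟩
  · by_contra! h0
    exact hne h0.1 h0.2
  · rw [toBilin'_comm_of_isSymm hA, toBilin'_comm_of_isSymm hB, Matrix.toBilin'_apply',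
      Matrix.toBilin'_apply', ← smul_eq_mul, ← smul_eq_mul, ← dotProduct_smul, ← dotProduct_smul,
      ← dotProduct_add, hab, dotProduct_zero]

theorem continuous_toBilin'_apply (x y : Fin n → ℝ) :
    Continuous fun A : Matrix (Fin n) (Fin n) ℝ => Matrix.toBilin' A x y := by
  simp only [Matrix.toBilin'_apply']
  fun_prop

end Matrices

/-! ### The main theorem -/

/-- The norm on matrices is the Euclidean operator norm. The threshold `δ` may depend on
`n`, `W`, `r` and `A`, but not on `B`. -/
theorem theorem2p5 (n : ℕ) (W : Submodule ℝ (Matrix (Fin n) (Fin n) ℝ))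
    (hWsym : W ≤ SymMat n) (hW : W ≠ ⊥) (r : ℝ) (hr : 0 ≤ r)
    (A : Matrix (Fin n) (Fin n) ℝ) (hA : HasMaximalRankIn A W)
    (k l₁ : ℕ) (hsig : HasSignature A k l₁) (hk : 2 ≤ k) :
    ∃ δ : ℝ, 0 < δ ∧ ∀ B ∈ W, ‖B - A‖ < δ →
      BoundaryIsHypersurface r A → BoundaryIsHypersurface r B →
      (¬ ∃ z : Fin n → ℝ, IntersectTransversallyAt r A B z) →
      Gam r A ⊆ Gam r B ∨ Gam r B ⊆ Gam r A := by
  have hAsym : A.IsSymm := hWsym hA.1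
  have hpos := exists_pos_orthogonal (A := A) (by rw [hsig.1]; exact hk)
  obtain ⟨p, hAp, -⟩ := hpos 0
  -- `q` is fixed before `B`, so `δ` is independent of `B`; `0` is a dummy value.
  obtain ⟨q, hq⟩ : ∃ q, BoundaryIsHypersurface 0 A → Matrix.toBilin' A q q < 0 := by
    by_cases h : BoundaryIsHypersurface 0 A
    · obtain ⟨q, hq⟩ := exists_neg_of_boundaryIsHypersurface hAsym h
      exact ⟨q, fun _ => hq⟩
    · exact ⟨0, fun h' => absurd h' h⟩
  have hev : ∀ᶠ B in 𝓝 A, 0 < Matrix.toBilin' B p p ∧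
      (Matrix.toBilin' A q q < 0 → Matrix.toBilin' B q q < 0) := by
    refine ((continuous_toBilin'_apply p p).continuousAt.eventually_const_lt hAp).and ?_
    by_cases h : Matrix.toBilin' A q q < 0
    · filter_upwards [(continuous_toBilin'_apply q q).continuousAt.eventually_lt_const h]
        with B hB _ using hB
    · exact Eventually.of_forall fun _ h' => absurd h' h
  obtain ⟨δ, hδ, hball⟩ := Metric.eventually_nhds_iff.1 hev
  refine ⟨δ, hδ, fun B hBW hBA hbA _ hnt => ?_⟩
  have hBsym : B.IsSymm := hWsym hBW
  obtain ⟨hBp, hBq⟩ := hball (y := B) (by rwa [dist_eq_norm])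
  have htan := tangentAlongLevel_of_not_intersectTransversally hAsym hBsym hAp hBp hnt
  have hAc := toBilin'_comm_of_isSymm hAsym
  have hBc := toBilin'_comm_of_isSymm hBsym
  rw [Gam_eq, Gam_eq]
  rcases hr.eq_or_lt with rfl | hr
  · refine htan.sublevel_zero_subset hAc hBc hpos (fun u hu => ?_) hAp hBp (hq hbA) (hBq (hq hbA))
    rw [Matrix.toBilin'_apply']
    refine hA.dotProduct_mulVec_eq_zero hAsym hBW ?_
    rw [← dotProduct_self_eq_zero, ← Matrix.toBilin'_apply', hAc, hu, LinearMap.zero_apply]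
  · exact htan.sublevel_subset_of_pos hr hAc hBc hAp hBp
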